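/- Let $\mathcal{E}$ be an elementary topos with chosen finite products, let $(\Sigma,E)$ be a variety (a set $\Sigma$ of operation symbols of finite arities and a set $E$ of equations between $\Sigma$-terms in finitely many variables), and let $(Q,\otimes,k,\bigvee)$ be an internal commutative quantale in $\mathcal{E}$, that is, an internal partial order with a join morphism $\bigvee:\Omega^Q\to Q$ and an internal commutative monoid structure whose multiplication preserves joins in each argument. All formulas below are read in the internal language of $\mathcal{E}$. A $Q$-relation from $A$ to $B$ is a morphism $R:A\times B\to Q$ of $\mathcal{E}$. For $(\Sigma,E)$-algebras $A,B$ in $\mathcal{E}$ it is called algebraic if, for every $n$ and every $n$-ary $\sigma\in\Sigma$, $$R(a_1,b_1)\otimes\cdots\otimes R(a_n,b_n)\le R(\sigma(a_1,\dots,a_n),\sigma(b_1,\dots,b_n)).$$ For $Q$-relations put $R\subseteq R'$ iff $\forall a,b.\ R(a,b)\le R'(a,b)$. Theorem. The $(\Sigma,E)$-algebras in $\mathcal{E}$ and the algebraic $Q$-relations between them form a partially ordered symmetric monoidal category $\mathbf{Rel}_{(\Sigma,E)}(Q)$, with the following structure. - The identities are $1_A(a,a')=\bigvee\{k\mid a=a'\}$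 and the composition is $(S\circ R)(a,c)=\bigvee_b R(a,b)\otimes S(b,c)$. - The tensor product of objects is the product of algebras, the monoidal unit is the terminal algebra, and $(R\otimes R')((a,a'),(b,b'))=R(a,b)\otimes R'(a',b')$. - The associators, the left and right unitors and the symmetries are the graphs $f_\circ(a,b)=\bigvee\{k\mid f(a)=b\}$ of the corresponding canonical isomorphisms $f$ of the finite products in $\mathcal{E}$. - The relation $\subseteq$ is a partial order on each hom-set, and composition and tensor are monotone in both arguments: if $R\subseteq R'$ and $S\subseteq S'$, then $S\circ R\subseteq S'\circ R'$ (for composable relations) and $R\otimes S\subseteq R'\otimes S'$. -/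

import Mathlib

open CategoryTheory Limits MonoidalCategory CartesianMonoidalCategory MonObj

universe v u w

namespace QRel

/-! An elementary topos is a category `C` with finite limits (with chosen finite products, i.e. a
`CartesianMonoidalCategory`), exponentials and a subobject classifier.

Statements in the internal language are spelled out on generalized elements `x : X ⟶ A`
(Kripke–Joyal semantics): an internal universal quantifier or implication becomes a quantifier over
all generalized elements at all later stages `Z ⟶ X`. -/

/-- An internal partially ordered object: an order relation `≤`, given as a subobject of
`obj ⊗ obj`, which is reflexive, transitive and antisymmetric. -/
structure InternalPoset (C : Type u) [Category.{v} C] [CartesianMonoidalCategory C] where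
  obj : C
  rel : Subobject (obj ⊗ obj)
  refl : ∀ {X : C} (a : X ⟶ obj), rel.Factors (lift a a)
  trans : ∀ {X : C} (a b c : X ⟶ obj),
    rel.Factors (lift a b) → rel.Factors (lift b c) → rel.Factors (lift a c)
  antisymm : ∀ {X : C} (a b : X ⟶ obj),
    rel.Factors (lift a b) → rel.Factors (lift b a) → a = b

namespace InternalPoset

variable {C : Type u} [Category.{v} C] [CartesianMonoidalCategory C]

/-- The internal order on generalized elements. -/
def LE (Q : InternalPoset C) {X : C} (a b : X ⟶ Q.obj) : Prop :=
  Q.rel.Factors (lift a b)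

/-- A predicate `P x b` on pairs of generalized elements `x` of `X` and `b` of `Q` at a common stage
describes an internal family of sets `{b | P x b}` of elements of `Q`, indexed by `x` in `X`.
`Q.IsJoin P s` says that internally `s x = ⋁ {b | P x b}` for all `x`: the
element `s x` is below `q` exactly when every `b` with `P x b` is below `q`. -/
def IsJoin (Q : InternalPoset C) {X : C}
    (P : ∀ ⦃Z : C⦄, (Z ⟶ X) → (Z ⟶ Q.obj) → Prop) (s : X ⟶ Q.obj) : Prop :=
  ∀ ⦃Y : C⦄ (x : Y ⟶ X) (q : Y ⟶ Q.obj),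
    Q.LE (x ≫ s) q ↔ ∀ ⦃Z : C⦄ (z : Z ⟶ Y) (b : Z ⟶ Q.obj), P (z ≫ x) b → Q.LE b (z ≫ q)

end InternalPoset

section Topos

variable {C : Type u} [Category.{v} C] [CartesianMonoidalCategory C]
  [MonoidalClosed C] [HasSubobjectClassifier C]

/-- The power object `Ω ^ A`. -/
noncomputable abbrev power (A : C) : C := (ihom A).obj (HasSubobjectClassifier.Ω C)

/-- The membership relation `b ∈ S`, for generalized elements of `A` and of its power object. -/
def Mem {A X : C} (b : X ⟶ A) (S : X ⟶ power A) : Prop :=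
  lift b S ≫ (ihom.ev A).app (HasSubobjectClassifier.Ω C) =
    Subobject.Classifier.χ₀ _ X ≫ HasSubobjectClassifier.truth C

/-- An internal (unital) quantale: an internal partial order with a join operation `Ω ^ Q ⟶ Q` and
an internal monoid structure which preserves joins in each argument. Products of generalized
elements are those of Mathlib's monoid structure on `X ⟶ obj`. -/
structure InternalQuantale (C : Type u) [Category.{v} C] [CartesianMonoidalCategory C]
    [MonoidalClosed C] [HasSubobjectClassifier C] extends InternalPoset C where
  mon : MonObj obj
  sup : power obj ⟶ obj
  isJoin_sup : ∀ {X : C} (S : X ⟶ power obj),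
    toInternalPoset.IsJoin (fun _ x b => Mem b (x ≫ S)) (S ≫ sup)
  mul_sup : ∀ {X : C} (a : X ⟶ obj) (S : X ⟶ power obj),
    toInternalPoset.IsJoin (fun _ x c => ∃ b, Mem b (x ≫ S) ∧ c = (x ≫ a) * b) (a * (S ≫ sup))
  sup_mul : ∀ {X : C} (S : X ⟶ power obj) (b : X ⟶ obj),
    toInternalPoset.IsJoin (fun _ x c => ∃ a, Mem a (x ≫ S) ∧ c = a * (x ≫ b)) ((S ≫ sup) * b)

attribute [instance] InternalQuantale.mon

/-- Commutativity of an internal quantale. -/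
def InternalQuantale.IsCommutative (Q : InternalQuantale C) : Prop :=
  ∀ {X : C} (a b : X ⟶ Q.obj), a * b = b * a

end Topos

/-- A variety `(Σ, E)`: operation symbols of finite arities, and a set of equations between terms in
finitely many variables. -/
structure Variety where
  Op : ℕ → Type w
  eqs : ∀ n : ℕ, Set
    ((FirstOrder.Language.mk Op fun _ => Empty).Term (Fin n) ×
      (FirstOrder.Language.mk Op fun _ => Empty).Term (Fin n))

/-- The terms of a variety over a set of variables. -/
abbrev Variety.Term (V : Variety.{w}) (α : Type) : Type w :=
  (FirstOrder.Language.mk V.Op fun _ => Empty).Term α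

section Algebra

variable {C : Type u} [Category.{v} C] [HasFiniteLimits C]

/-- The value of a term at generalized elements of `A`, given operations on `A`. -/
noncomputable def termValue (V : Variety.{w}) {A : C}
    (op : ∀ {n : ℕ}, V.Op n → ((∏ᶜ fun _ : Fin n => A) ⟶ A)) {X : C} {α : Type}
    (a : α → (X ⟶ A)) : V.Term α → (X ⟶ A)
  | .var i => a i
  | .func σ ts => Pi.lift (fun i => termValue V op a (ts i)) ≫ op σ

/-- A `(Σ, E)`-algebra in `C`. -/
structure Alg (V : Variety.{w}) (C : Type u) [Category.{v} C] [HasFiniteLimits C] where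
  carrier : C
  op : ∀ {n : ℕ}, V.Op n → ((∏ᶜ fun _ : Fin n => carrier) ⟶ carrier)
  sat : ∀ (n : ℕ) (e : V.Term (Fin n) × V.Term (Fin n)), e ∈ V.eqs n →
    ∀ {X : C} (a : Fin n → (X ⟶ carrier)), termValue V op a e.1 = termValue V op a e.2

variable {V : Variety.{w}}

/-- `σ(a₁, …, aₙ)` for generalized elements `a₁, …, aₙ` of an algebra. -/
noncomputable def Alg.app (A : Alg V C) {n : ℕ} (σ : V.Op n) {X : C}
    (a : Fin n → (X ⟶ A.carrier)) : X ⟶ A.carrier :=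
  Pi.lift a ≫ A.op σ

/-- Operations compatible with a morphism commute with evaluation of terms. -/
theorem termValue_comp {A B : C}
    (opA : ∀ {n : ℕ}, V.Op n → ((∏ᶜ fun _ : Fin n => A) ⟶ A))
    (opB : ∀ {n : ℕ}, V.Op n → ((∏ᶜ fun _ : Fin n => B) ⟶ B)) (f : A ⟶ B)
    (hf : ∀ {n : ℕ} (σ : V.Op n), opA σ ≫ f = Limits.Pi.map (fun _ => f) ≫ opB σ)
    {X : C} {α : Type} (a : α → (X ⟶ A)) (t : V.Term α) :
    termValue V opA a t ≫ f = termValue V opB (fun i => a i ≫ f) t := by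
  induction t with
  | var i => rfl
  | func σ ts ih =>
    simp only [termValue, Category.assoc, hf]
    rw [← Category.assoc]
    congr 1
    ext i
    simp [ih]

variable [CartesianMonoidalCategory C]

/-- The product of two algebras, with componentwise operations. -/
noncomputable abbrev Alg.prod (A B : Alg V C) : Alg V C where
  carrier := A.carrier ⊗ B.carrier
  op σ := lift (Limits.Pi.map (fun _ => fst A.carrier B.carrier) ≫ A.op σ)
    (Limits.Pi.map (fun _ => snd A.carrier B.carrier) ≫ B.op σ)
  sat n e he X a := by
    apply CartesianMonoidalCategory.hom_ext
    · rw [termValue_comp _ A.op (fst A.carrier B.carrier) (by intros; simp),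
        termValue_comp _ A.op (fst A.carrier B.carrier) (by intros; simp), A.sat n e he]
    · rw [termValue_comp _ B.op (snd A.carrier B.carrier) (by intros; simp),
        termValue_comp _ B.op (snd A.carrier B.carrier) (by intros; simp), B.sat n e he]

/-- The terminal algebra. -/
noncomputable abbrev Alg.unit : Alg V C where
  carrier := 𝟙_ C
  op _ := toUnit _
  sat _ _ _ _ _ := toUnit_unique _ _

end Algebra

section Relations

variable {C : Type u} [Category.{v} C] [HasFiniteLimits C] [CartesianMonoidalCategory C]
  [MonoidalClosed C] [HasSubobjectClassifier C]

/-- A `Q`-relation between objects `A` and `B`. -/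
abbrev Rel (Q : InternalQuantale C) (A B : C) : Type v := A ⊗ B ⟶ Q.obj

namespace Rel

variable {Q : InternalQuantale C}

/-- The truth value `R(a, b)`. -/
def val {A B : C} (R : Rel Q A B) {X : C} (a : X ⟶ A) (b : X ⟶ B) : X ⟶ Q.obj :=
  lift a b ≫ R

/-- The order on `Q`-relations: `∀ a b, R(a, b) ≤ R'(a, b)`. -/
def Sub {A B : C} (R R' : Rel Q A B) : Prop :=
  ∀ ⦃X : C⦄ (a : X ⟶ A) (b : X ⟶ B), Q.LE (R.val a b) (R'.val a b)

/-- `T` is the graph of `f`: `T(a, b) = ⋁ {k | f(a) = b}`. -/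
def IsGraph {A B : C} (f : A ⟶ B) (T : Rel Q A B) : Prop :=
  Q.IsJoin (X := A ⊗ B) (fun _ x t => (x ≫ fst A B) ≫ f = x ≫ snd A B ∧ t = 1) T

/-- `T` is the identity relation: `T(a, a') = ⋁ {k | a = a'}`. -/
def IsIdentity {A : C} (T : Rel Q A A) : Prop :=
  Q.IsJoin (X := A ⊗ A) (fun _ x t => x ≫ fst A A = x ≫ snd A A ∧ t = 1) T

/-- `T` is the composite of `R : A → B` and `S : B → D`:
`T(a, d) = ⋁_b R(a, b) ⊗ S(b, d)`. -/
def IsComposite {A B D : C} (R : Rel Q A B) (S : Rel Q B D) (T : Rel Q A D) : Prop :=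
  Q.IsJoin (X := A ⊗ D)
    (fun Z x t => ∃ b : Z ⟶ B, t = R.val (x ≫ fst A D) b * S.val b (x ≫ snd A D)) T

/-- The tensor of relations: `(R ⊗ R')((a, a'), (b, b')) = R(a, b) ⊗ R'(a', b')`. -/
def tensor {A B A' B' : C} (R : Rel Q A B) (R' : Rel Q A' B') : Rel Q (A ⊗ A') (B ⊗ B') :=
  R.val (fst (A ⊗ A') (B ⊗ B') ≫ fst A A') (snd (A ⊗ A') (B ⊗ B') ≫ fst B B') *
    R'.val (fst (A ⊗ A') (B ⊗ B') ≫ snd A A') (snd (A ⊗ A') (B ⊗ B') ≫ snd B B')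

end Rel

/-- Algebraic `Q`-relations:
`R(a₁, b₁) ⊗ ⋯ ⊗ R(aₙ, bₙ) ≤ R(σ(a₁, …, aₙ), σ(b₁, …, bₙ))` for every operation `σ`. -/
def IsAlgebraic {V : Variety.{w}} (Q : InternalQuantale C) (A B : Alg V C)
    (R : Rel Q A.carrier B.carrier) : Prop :=
  ∀ ⦃n : ℕ⦄ (σ : V.Op n) ⦃X : C⦄ (a : Fin n → (X ⟶ A.carrier)) (b : Fin n → (X ⟶ B.carrier)),
    Q.LE (List.ofFn fun i => R.val (a i) (b i)).prod (R.val (A.app σ a) (B.app σ b))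

/-- The type of algebraic `Q`-relations between two algebras. -/
def AlgRel {V : Variety.{w}} (Q : InternalQuantale C) (A B : Alg V C) : Type v :=
  {R : Rel Q A.carrier B.carrier // IsAlgebraic Q A B R}

namespace AlgRel

variable {V : Variety.{w}} {Q : InternalQuantale C}

/-- The `Q`-relation underlying an algebraic `Q`-relation, viewed as a relation between algebras
`A'` and `B'` that are equal to the given ones. -/
def relOf {A B A' B' : Alg V C} (hA : A = A') (hB : B = B') (R : AlgRel Q A B) :
    Rel Q A'.carrier B'.carrier := by
  subst hA hB
  exact R.1

/-- The underlying `Q`-relation. -/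
abbrev rel {A B : Alg V C} (R : AlgRel Q A B) : Rel Q A.carrier B.carrier := R.1

end AlgRel

end Relations

/-- A partially ordered symmetric monoidal category: a symmetric monoidal category with a partial
order on every hom-set, such that composition and tensor are monotone in both arguments. -/
structure IsPartiallyOrderedSMC (R : Type u) [Category.{v} R] [MonoidalCategory R]
    [SymmetricCategory R] [∀ A B : R, PartialOrder (A ⟶ B)] : Prop where
  comp_mono : ∀ {A B D : R} {f f' : A ⟶ B} {g g' : B ⟶ D}, f ≤ f' → g ≤ g' → f ≫ g ≤ f' ≫ g'
  tensor_mono : ∀ {A B A' B' : R} {f f' : A ⟶ B} {g g' : A' ⟶ B'},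
    f ≤ f' → g ≤ g' → f ⊗ₘ g ≤ f' ⊗ₘ g'

end QRel

/-! Two values in `Q` are equal as soon as they have the same upper bounds, and `⋁ P ≤ q` is a
universally quantified statement about the members of `P`. Multiplication by a fixed element has a
residual, so it too can be tested on the members of a join (`mul_isJoin_le_iff`). Associativity and
the interchange law thus reduce to equivalent universal statements about products in a commutative
monoid.

The joins exist because it suffices that their upper bounds be definable in the internal language
(`exists_isJoin`). Algebraic relations are closed under composition because finite products
distribute over joins (`IsCommutative.prod_isJoin_le`).

Coherence is inherited from `C`: graphs turn composition and products of morphisms into composition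
and tensor of relations (`graph_comp_graph`, `tensor_graph`). Naturality holds because composing
with the graph of an isomorphism is substitution (`graph_comp_val`, `comp_graph_val`). -/

namespace QRel

set_option linter.unusedSectionVars false

/-! ### Predicates definable in the internal language. -/

section Definable

variable {C : Type u} [Category.{v} C] [HasFiniteLimits C] [HasSubobjectClassifier C]

/-- The generalized element "true" of the subobject classifier. -/
noncomputable def tt (X : C) : X ⟶ HasSubobjectClassifier.Ω C :=
  Subobject.Classifier.χ₀ _ X ≫ HasSubobjectClassifier.truth C

theorem comp_tt {X Y : C} (f : X ⟶ Y) : f ≫ tt Y = tt X := by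
  rw [tt, ← Category.assoc]
  congr 1
  exact (Subobject.Classifier.isTerminalΩ₀ (c := _)).hom_ext _ _

theorem comp_χ_eq_tt_iff {U X Z : C} (m : U ⟶ X) [Mono m] (z : Z ⟶ X) :
    z ≫ HasSubobjectClassifier.χ m = tt Z ↔ ∃ l : Z ⟶ U, l ≫ m = z := by
  constructor
  · intro h
    exact ⟨(HasSubobjectClassifier.isPullback_χ m).lift z _ h,
      (HasSubobjectClassifier.isPullback_χ m).lift_fst _ _ _⟩
  · rintro ⟨l, rfl⟩
    rw [Category.assoc, HasSubobjectClassifier.comm]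
    exact comp_tt l

/-- Two truth values which are true at the same stages are equal. -/
theorem truth_ext {X : C} {f g : X ⟶ HasSubobjectClassifier.Ω C}
    (h : ∀ ⦃Z : C⦄ (z : Z ⟶ X), z ≫ f = tt Z ↔ z ≫ g = tt Z) : f = g := by
  -- Any such `g`, including `f` itself, classifies the subobject on which `f` is true, and
  -- characteristic morphisms are unique.
  have key : ∀ g : X ⟶ HasSubobjectClassifier.Ω C,
      (∀ ⦃Z : C⦄ (z : Z ⟶ X), z ≫ f = tt Z ↔ z ≫ g = tt Z) →
      g = HasSubobjectClassifier.χ (pullback.fst f (HasSubobjectClassifier.truth C)) := by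
    intro g h
    have hm : pullback.fst f (HasSubobjectClassifier.truth C) ≫ f = tt _ := by
      rw [pullback.condition, tt]
      congr 1
      exact (Subobject.Classifier.isTerminalΩ₀ (c := _)).hom_ext _ _
    apply HasSubobjectClassifier.unique
    refine ⟨⟨(h _).1 hm⟩, ⟨PullbackCone.IsLimit.mk _
      (fun s => pullback.lift s.fst s.snd ?_) ?_ ?_ ?_⟩⟩
    · have hs : s.fst ≫ g = tt _ := by
        rw [s.condition, tt]
        congr 1
        exact (Subobject.Classifier.isTerminalΩ₀ (c := _)).hom_ext _ _
      rw [(h _).2 hs, tt]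
      congr 1
      exact (Subobject.Classifier.isTerminalΩ₀ (c := _)).hom_ext _ _
    · intro s
      exact pullback.lift_fst _ _ _
    · intro s
      exact (Subobject.Classifier.isTerminalΩ₀ (c := _)).hom_ext _ _
    · intro s m hm _
      rw [← cancel_mono (pullback.fst f (HasSubobjectClassifier.truth C)), hm, pullback.lift_fst]
  rw [key f fun _ _ => Iff.rfl, ← key g h]

/-- A predicate on the generalized elements of `X` is definable if it is classified by a morphism
to the subobject classifier. -/
def Definable {X : C} (P : ∀ ⦃Z : C⦄, (Z ⟶ X) → Prop) : Prop :=
  ∃ χ : X ⟶ HasSubobjectClassifier.Ω C, ∀ ⦃Z : C⦄ (z : Z ⟶ X), P z ↔ z ≫ χ = tt Z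

namespace Definable

theorem comp {X Y : C} {P : ∀ ⦃Z : C⦄, (Z ⟶ X) → Prop} (hP : Definable P) (f : Y ⟶ X) :
    Definable fun _ z => P (z ≫ f) := by
  obtain ⟨χ, h⟩ := hP
  exact ⟨f ≫ χ, fun Z z => by simp only [h, Category.assoc]⟩

theorem eq {X Y : C} (f g : X ⟶ Y) : Definable fun _ z => z ≫ f = z ≫ g := by
  refine ⟨HasSubobjectClassifier.χ (equalizer.ι f g), fun Z z => ?_⟩
  rw [comp_χ_eq_tt_iff]
  constructor
  · intro h
    exact ⟨equalizer.lift z h, equalizer.lift_ι _ _⟩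
  · rintro ⟨l, rfl⟩
    rw [Category.assoc, Category.assoc, equalizer.condition]

theorem of_iff {X : C} {P P' : ∀ ⦃Z : C⦄, (Z ⟶ X) → Prop} (hP : Definable P)
    (h : ∀ ⦃Z : C⦄ (z : Z ⟶ X), P' z ↔ P z) : Definable P' := by
  obtain ⟨χ, hχ⟩ := hP
  exact ⟨χ, fun Z z => (h z).trans (hχ z)⟩

theorem mono {X : C} {P : ∀ ⦃Z : C⦄, (Z ⟶ X) → Prop} (hP : Definable P) {Z W : C} (w : W ⟶ Z)
    {z : Z ⟶ X} (h : P z) : P (w ≫ z) := by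
  obtain ⟨χ, hχ⟩ := hP
  rw [hχ] at h ⊢
  rw [Category.assoc, h, comp_tt]

variable [CartesianMonoidalCategory C]

theorem and {X : C} {P P' : ∀ ⦃Z : C⦄, (Z ⟶ X) → Prop} (hP : Definable P) (hP' : Definable P') :
    Definable fun _ z => P z ∧ P' z := by
  obtain ⟨χ, h⟩ := hP
  obtain ⟨χ', h'⟩ := hP'
  refine (eq (lift χ χ') (lift (tt X) (tt X))).of_iff fun Z z => ?_
  rw [comp_lift, comp_lift, comp_tt, h, h']
  constructor
  · rintro ⟨h₁, h₂⟩
    rw [h₁, h₂]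
  · intro e
    exact ⟨by simpa using congr($e ≫ fst _ _), by simpa using congr($e ≫ snd _ _)⟩

/-- In a Heyting algebra `P ⇒ P'` is the equation `P ∧ P' = P`; equality of truth values is tested
at all later stages, which yields the quantifier over `w`. -/
theorem imp {X : C} {P P' : ∀ ⦃Z : C⦄, (Z ⟶ X) → Prop} (hP : Definable P) (hP' : Definable P') :
    Definable fun Z z => ∀ ⦃W : C⦄ (w : W ⟶ Z), P (w ≫ z) → P' (w ≫ z) := by
  obtain ⟨ψ, hψ⟩ := hP.and hP'
  obtain ⟨χ, h⟩ := hP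
  refine (eq ψ χ).of_iff fun Z z => ?_
  constructor
  · intro H
    refine truth_ext fun W w => ?_
    rw [← Category.assoc, ← Category.assoc, ← h, ← hψ]
    exact ⟨fun H' => H'.1, fun H' => ⟨H', H w H'⟩⟩
  · intro e W w H
    rw [h, Category.assoc, ← e, ← Category.assoc, ← hψ] at H
    exact H.2

variable [MonoidalClosed C]

/-- A predicate holds for all `b` exactly when its transpose `X ⟶ Ω ^ B` equals the transpose of
"true", so definability reduces to that of an equation. -/
theorem all {X B : C} {P : ∀ ⦃Z : C⦄, (Z ⟶ X ⊗ B) → Prop} (hP : Definable P) :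
    Definable fun Z z => ∀ ⦃W : C⦄ (w : W ⟶ Z) (b : W ⟶ B), P (lift (w ≫ z) b) := by
  have hmono : ∀ {Z W : C} (w : W ⟶ Z) {z : Z ⟶ X ⊗ B}, P z → P (w ≫ z) :=
    fun w _ h => hP.mono w h
  obtain ⟨χ, h⟩ := hP
  refine (eq (MonoidalClosed.curry (lift (snd B X) (fst B X) ≫ χ))
    (MonoidalClosed.curry (tt (B ⊗ X)))).of_iff fun Z z => ?_
  rw [← MonoidalClosed.curry_natural_left, ← MonoidalClosed.curry_natural_left,
    MonoidalClosed.curry_injective.eq_iff, comp_tt, ← Category.assoc, ← h]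
  constructor
  · intro H
    -- The generic element of `B`, living at stage `B ⊗ Z`; every other instance is a restriction of
    -- this one.
    convert H (snd B Z) (fst B Z) using 1
    ext <;> simp
  · intro H W w b
    convert hmono (lift b w) H using 1
    ext <;> simp

/-- Internal comprehension: the name is the transpose of the characteristic morphism. -/
theorem exists_name {X A : C} {P : ∀ ⦃Z : C⦄, (Z ⟶ X ⊗ A) → Prop} (hP : Definable P) :
    ∃ S : X ⟶ power A, ∀ ⦃Z : C⦄ (x : Z ⟶ X) (a : Z ⟶ A), Mem a (x ≫ S) ↔ P (lift x a) := by
  obtain ⟨χ, h⟩ := hP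
  refine ⟨MonoidalClosed.curry (lift (snd A X) (fst A X) ≫ χ), fun Z x a => ?_⟩
  rw [h, Mem, ← tt]
  have : lift a (x ≫ MonoidalClosed.curry (lift (snd A X) (fst A X) ≫ χ)) =
      lift a x ≫ A ◁ MonoidalClosed.curry (lift (snd A X) (fst A X) ≫ χ) := by
    ext <;> simp
  rw [this, Category.assoc, ← MonoidalClosed.uncurry_eq, MonoidalClosed.uncurry_curry,
    ← Category.assoc]
  simp

end Definable

end Definable

/-! ### Order and joins on generalized elements. -/

namespace InternalPoset

variable {C : Type u} [Category.{v} C] [CartesianMonoidalCategory C] (Q : InternalPoset C)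

theorem LE.comp {Q : InternalPoset C} {X Y : C} {a b : X ⟶ Q.obj} (h : Q.LE a b) (f : Y ⟶ X) :
    Q.LE (f ≫ a) (f ≫ b) := by
  rw [LE, ← comp_lift]
  exact Subobject.factors_of_factors_right f h

theorem LE.trans {Q : InternalPoset C} {X : C} {a b c : X ⟶ Q.obj} (h : Q.LE a b)
    (h' : Q.LE b c) : Q.LE a c :=
  Q.trans a b c h h'

theorem le_refl {X : C} (a : X ⟶ Q.obj) : Q.LE a a := Q.refl a

theorem eq_of_forall_le_iff {X : C} {a b : X ⟶ Q.obj}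
    (h : ∀ q : X ⟶ Q.obj, Q.LE a q ↔ Q.LE b q) : a = b :=
  Q.antisymm a b ((h b).2 (Q.refl b)) ((h a).1 (Q.refl a))

theorem definable_le [HasFiniteLimits C] [HasSubobjectClassifier C] {X : C} (a b : X ⟶ Q.obj) :
    Definable fun _ z => Q.LE (z ≫ a) (z ≫ b) := by
  refine ⟨lift a b ≫ HasSubobjectClassifier.χ Q.rel.arrow, fun Z z => ?_⟩
  rw [← Category.assoc, comp_χ_eq_tt_iff, comp_lift]
  exact ⟨fun h => ⟨_, Q.rel.factorThru_arrow _ h⟩,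
    fun ⟨l, hl⟩ => by
      change Q.rel.Factors _
      rw [← hl]
      exact Subobject.factors_comp_arrow l⟩

variable {Q}

theorem IsJoin.comp {X Y : C} {P : ∀ ⦃Z : C⦄, (Z ⟶ X) → (Z ⟶ Q.obj) → Prop} {s : X ⟶ Q.obj}
    (h : Q.IsJoin P s) (f : Y ⟶ X) : Q.IsJoin (fun _ y b => P (y ≫ f) b) (f ≫ s) := by
  intro Z x q
  simpa using h (x ≫ f) q

theorem IsJoin.le_iff {X : C} {P : ∀ ⦃Z : C⦄, (Z ⟶ X) → (Z ⟶ Q.obj) → Prop} {s : X ⟶ Q.obj}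
    (h : Q.IsJoin P s) (q : X ⟶ Q.obj) :
    Q.LE s q ↔ ∀ ⦃Z : C⦄ (z : Z ⟶ X) (b : Z ⟶ Q.obj), P z b → Q.LE b (z ≫ q) := by
  simpa using h (𝟙 X) q

theorem IsJoin.le {X : C} {P : ∀ ⦃Z : C⦄, (Z ⟶ X) → (Z ⟶ Q.obj) → Prop} {s : X ⟶ Q.obj}
    (h : Q.IsJoin P s) {b : X ⟶ Q.obj} (hb : P (𝟙 X) b) : Q.LE b s := by
  simpa using (h.le_iff s).1 (Q.refl s) (𝟙 X) b hb

theorem IsJoin.unique {X : C} {P : ∀ ⦃Z : C⦄, (Z ⟶ X) → (Z ⟶ Q.obj) → Prop} {s t : X ⟶ Q.obj}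
    (h : Q.IsJoin P s) (h' : Q.IsJoin P t) : s = t :=
  Q.eq_of_forall_le_iff fun q => (h.le_iff q).trans (h'.le_iff q).symm

end InternalPoset

/-! ### Existence of joins, residuals and distributivity. -/

namespace InternalQuantale

open InternalPoset

variable {C : Type u} [Category.{v} C] [HasFiniteLimits C] [CartesianMonoidalCategory C]
  [MonoidalClosed C] [HasSubobjectClassifier C] (Q : InternalQuantale C)

/-- A family of elements has a join as soon as its upper bounds are definable. -/
theorem exists_isJoin {X : C} (P : ∀ ⦃Z : C⦄, (Z ⟶ X) → (Z ⟶ Q.obj) → Prop)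
    (hst : ∀ ⦃Z W : C⦄ (w : W ⟶ Z) {z : Z ⟶ X} {b : Z ⟶ Q.obj}, P z b → P (w ≫ z) (w ≫ b))
    (hP : Definable fun (Z : C) (z : Z ⟶ X ⊗ Q.obj) =>
      ∀ ⦃W : C⦄ (w : W ⟶ Z) (b : W ⟶ Q.obj), P (w ≫ z ≫ fst _ _) b → Q.LE b (w ≫ z ≫ snd _ _)) :
    ∃ s : X ⟶ Q.obj, Q.IsJoin P s := by
  -- `P` itself need not be definable, so it has no name. The set of lower bounds of its upper
  -- bounds is definable and has the same upper bounds; its join is the one sought.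
  have hL := ((hP.comp (lift (fst (X ⊗ Q.obj) Q.obj ≫ fst _ _) (snd _ _))).imp
    (Q.definable_le (fst (X ⊗ Q.obj) Q.obj ≫ snd _ _) (snd _ _))).all
  obtain ⟨S, hS⟩ := hL.exists_name
  refine ⟨S ≫ Q.sup, fun Y x q => ?_⟩
  rw [Q.isJoin_sup S x q]
  constructor
  · intro H Z z b hb
    refine H z b ((hS _ _).2 fun W w q' V v' hu => ?_)
    simpa using hu (𝟙 V) (v' ≫ w ≫ b) (by simpa using hst v' (hst w hb))
  · intro H Z z b hb
    simpa using (hS _ _).1 hb (𝟙 Z) (z ≫ q) (𝟙 Z) fun W w c hc => by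
      simpa using H (w ≫ z) c (by simpa using hc)

theorem exists_name_le {X : C} (b : X ⟶ Q.obj) :
    ∃ S : X ⟶ power Q.obj,
      ∀ ⦃Z : C⦄ (x : Z ⟶ X) (a : Z ⟶ Q.obj), Mem a (x ≫ S) ↔ Q.LE a (x ≫ b) := by
  obtain ⟨S, hS⟩ := (Q.definable_le (snd X Q.obj) (fst X Q.obj ≫ b)).exists_name
  exact ⟨S, fun Z x a => by simpa using hS x a⟩

variable {Q}

/-- Here `b` is the join of its down-set, of which `a` is a member, and multiplication by `c`
preserves this join. -/
theorem mul_le_mul_left {X : C} {a b : X ⟶ Q.obj} (h : Q.LE a b) (c : X ⟶ Q.obj) :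
    Q.LE (c * a) (c * b) := by
  obtain ⟨S, hS⟩ := Q.exists_name_le b
  have hb : S ≫ Q.sup = b := by
    refine Q.eq_of_forall_le_iff fun q => ((Q.isJoin_sup S).le_iff q).trans ⟨fun H => ?_, ?_⟩
    · simpa using H (𝟙 X) b ((hS _ _).2 (by simpa using Q.le_refl b))
    · intro H Z z d hd
      exact ((hS _ _).1 hd).trans (H.comp z)
  have := (Q.mul_sup c S).le (b := c * a) ⟨a, (hS _ _).2 (by simpa using h), by simp⟩
  rwa [hb] at this

theorem mul_le_mul_right {X : C} {a b : X ⟶ Q.obj} (h : Q.LE a b) (c : X ⟶ Q.obj) :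
    Q.LE (a * c) (b * c) := by
  obtain ⟨S, hS⟩ := Q.exists_name_le b
  have hb : S ≫ Q.sup = b := by
    refine Q.eq_of_forall_le_iff fun q => ((Q.isJoin_sup S).le_iff q).trans ⟨fun H => ?_, ?_⟩
    · simpa using H (𝟙 X) b ((hS _ _).2 (by simpa using Q.le_refl b))
    · intro H Z z d hd
      exact ((hS _ _).1 hd).trans (H.comp z)
  have := (Q.sup_mul S c).le (b := a * c) ⟨a, (hS _ _).2 (by simpa using h), by simp⟩
  rwa [hb] at this

theorem mul_le_mul {X : C} {a b c d : X ⟶ Q.obj} (h : Q.LE a b) (h' : Q.LE c d) :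
    Q.LE (a * c) (b * d) :=
  (mul_le_mul_right h c).trans (mul_le_mul_left h' b)

variable (Q) in
/-- Residuals exist in an internal quantale. -/
theorem exists_residual {X : C} (a q : X ⟶ Q.obj) :
    ∃ r : X ⟶ Q.obj, ∀ ⦃Z : C⦄ (z : Z ⟶ X) (b : Z ⟶ Q.obj),
      Q.LE b (z ≫ r) ↔ Q.LE ((z ≫ a) * b) (z ≫ q) := by
  -- The residual is the join of all `b` with `a * b ≤ q`.
  obtain ⟨S, hS⟩ := (Q.definable_le ((fst X Q.obj ≫ a) * snd X Q.obj)
    (fst X Q.obj ≫ q)).exists_name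
  replace hS : ∀ ⦃Z : C⦄ (x : Z ⟶ X) (b : Z ⟶ Q.obj),
      Mem b (x ≫ S) ↔ Q.LE ((x ≫ a) * b) (x ≫ q) := fun Z x b => by
    simpa [MonObj.comp_mul] using hS x b
  refine ⟨S ≫ Q.sup, fun Z z b => ⟨fun h => ?_, fun h => ?_⟩⟩
  · refine (mul_le_mul_left h _).trans ?_
    have := (Q.mul_sup a S z (z ≫ q)).2 ?_
    · simpa [MonObj.comp_mul] using this
    · rintro W w _ ⟨c, hc, rfl⟩
      simpa using (hS _ _).1 hc
  · have := ((Q.isJoin_sup S).comp z).le (b := b) (by simpa using (hS _ _).2 h)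
    exact this

/-- The axiom `mul_sup` speaks only of subsets named by a morphism to the power object. The residual
adjunction extends it to joins of arbitrary predicates. -/
theorem mul_isJoin_le_iff {X : C} {P : ∀ ⦃Z : C⦄, (Z ⟶ X) → (Z ⟶ Q.obj) → Prop} {s : X ⟶ Q.obj}
    (h : Q.IsJoin P s) (a q : X ⟶ Q.obj) :
    Q.LE (a * s) q ↔
      ∀ ⦃Z : C⦄ (z : Z ⟶ X) (b : Z ⟶ Q.obj), P z b → Q.LE ((z ≫ a) * b) (z ≫ q) := by
  obtain ⟨r, hr⟩ := Q.exists_residual a q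
  have := hr (𝟙 X) s
  rw [Category.id_comp, Category.id_comp, Category.id_comp] at this
  rw [← this, h.le_iff]
  simp only [hr]

theorem prod_comp {n : ℕ} {X Y : C} (f : Y ⟶ X) (s : Fin n → (X ⟶ Q.obj)) :
    f ≫ (List.ofFn s).prod = (List.ofFn fun i => f ≫ s i).prod := by
  induction n with
  | zero => simp [MonObj.comp_one]
  | succ n ih => simp [List.ofFn_succ, MonObj.comp_mul, ih]

theorem IsCommutative.isJoin_mul_le_iff (hQ : Q.IsCommutative) {X : C}
    {P : ∀ ⦃Z : C⦄, (Z ⟶ X) → (Z ⟶ Q.obj) → Prop} {s : X ⟶ Q.obj}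
    (h : Q.IsJoin P s) (a q : X ⟶ Q.obj) :
    Q.LE (s * a) q ↔
      ∀ ⦃Z : C⦄ (z : Z ⟶ X) (b : Z ⟶ Q.obj), P z b → Q.LE (b * (z ≫ a)) (z ≫ q) := by
  rw [hQ, mul_isJoin_le_iff h]
  simp only [hQ (_ ≫ a)]

theorem IsCommutative.mul_mul_mul_comm (hQ : Q.IsCommutative) {X : C} (a b c d : X ⟶ Q.obj) :
    a * b * (c * d) = a * c * (b * d) := by
  rw [_root_.mul_assoc, _root_.mul_assoc, ← _root_.mul_assoc b, hQ b c, _root_.mul_assoc]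

theorem IsCommutative.prod_mul (hQ : Q.IsCommutative) {n : ℕ} {X : C}
    (s t : Fin n → (X ⟶ Q.obj)) :
    (List.ofFn fun i => s i * t i).prod = (List.ofFn s).prod * (List.ofFn t).prod := by
  induction n with
  | zero => simp
  | succ n ih =>
    simp only [List.ofFn_succ, List.prod_cons]
    rw [ih (fun i => s i.succ) (fun i => t i.succ), hQ.mul_mul_mul_comm]

/-- Finite products distribute over joins. -/
theorem IsCommutative.prod_isJoin_le (hQ : Q.IsCommutative) {n : ℕ} {X : C}
    {P : Fin n → ∀ ⦃Z : C⦄, (Z ⟶ X) → (Z ⟶ Q.obj) → Prop} {s : Fin n → (X ⟶ Q.obj)}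
    (hst : ∀ i ⦃Z W : C⦄ (w : W ⟶ Z) {z : Z ⟶ X} {b : Z ⟶ Q.obj},
      P i z b → P i (w ≫ z) (w ≫ b))
    (h : ∀ i, Q.IsJoin (P i) (s i)) (q : X ⟶ Q.obj)
    (H : ∀ ⦃Z : C⦄ (z : Z ⟶ X) (b : Fin n → (Z ⟶ Q.obj)), (∀ i, P i z (b i)) →
      Q.LE (List.ofFn b).prod (z ≫ q)) :
    Q.LE (List.ofFn s).prod q := by
  induction n generalizing X with
  | zero => simpa using H (𝟙 X) Fin.elim0 fun i => i.elim0
  | succ n ih =>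
    simp only [List.ofFn_succ, List.prod_cons]
    rw [hQ.isJoin_mul_le_iff (h 0)]
    intro Z z b hb
    -- Moving the first factor across the inequality leaves a product of `n` joins below `r`, to
    -- which the induction hypothesis applies at stage `Z`.
    obtain ⟨r, hr⟩ := Q.exists_residual b (z ≫ q)
    rw [← Category.id_comp b, ← Category.id_comp (z ≫ q), ← hr, Category.id_comp, prod_comp]
    refine ih (P := fun i _ y c => P i.succ (y ≫ z) c) (fun i V W w y c hc => ?_)
      (fun i => (h i.succ).comp z) r fun W w c hc => ?_
    · simpa using hst i.succ w hc
    · rw [hr]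
      have := H (w ≫ z) (Fin.cons (w ≫ b) c) (Fin.cases (hst 0 w hb) hc)
      simpa [List.ofFn_succ] using this

end InternalQuantale
-- The calculus of `Q`-relations.
namespace Rel

open InternalPoset InternalQuantale

variable {C : Type u} [Category.{v} C] [HasFiniteLimits C] [CartesianMonoidalCategory C]
  [MonoidalClosed C] [HasSubobjectClassifier C] {Q : InternalQuantale C}

theorem comp_val {A B : C} (R : Rel Q A B) {X Y : C} (f : Y ⟶ X) (a : X ⟶ A) (b : X ⟶ B) :
    f ≫ val R a b = val R (f ≫ a) (f ≫ b) := by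
  rw [val, val, ← Category.assoc, comp_lift]

theorem val_fst_snd {A B : C} (R : Rel Q A B) : val R (fst A B) (snd A B) = R := by
  simp [val]

theorem ext_val {A B : C} {R S : Rel Q A B}
    (h : ∀ ⦃X : C⦄ (a : X ⟶ A) (b : X ⟶ B), val R a b = val S a b) : R = S := by
  rw [← val_fst_snd R, h, val_fst_snd]

/-- The existential over `b` becomes universal in the condition for upper bounds, which is therefore
definable. -/
theorem exists_isComposite {A B D : C} (R : Rel Q A B) (S : Rel Q B D) :
    ∃ T : Rel Q A D, IsComposite R S T := by
  refine Q.exists_isJoin _ ?_ ?_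
  · rintro Z W w x _ ⟨b, rfl⟩
    exact ⟨w ≫ b, by simp [MonObj.comp_mul, comp_val]⟩
  · refine (Q.definable_le
      (val R (fst ((A ⊗ D) ⊗ Q.obj) B ≫ fst _ _ ≫ fst _ _) (snd _ _) *
        val S (snd _ _) (fst ((A ⊗ D) ⊗ Q.obj) B ≫ fst _ _ ≫ snd _ _))
      (fst ((A ⊗ D) ⊗ Q.obj) B ≫ snd _ _)).all.of_iff fun Z z => ?_
    simp only [MonObj.comp_mul, comp_val, lift_fst_assoc, lift_snd, Category.assoc]
    constructor
    · intro H W w b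
      exact H w _ ⟨b, rfl⟩
    · rintro H W w _ ⟨b, rfl⟩
      exact H w b

theorem exists_isGraph (Q : InternalQuantale C) {A B : C} (f : A ⟶ B) :
    ∃ T : Rel Q A B, IsGraph f T := by
  refine Q.exists_isJoin _ ?_ ?_
  · rintro Z W w x _ ⟨h, rfl⟩
    exact ⟨by simpa using congr(w ≫ $h), MonObj.comp_one _⟩
  · refine ((Definable.eq (fst (A ⊗ B) Q.obj ≫ fst _ _ ≫ f) (fst (A ⊗ B) Q.obj ≫ snd _ _)).imp
      (Q.definable_le 1 (snd _ _))).of_iff fun Z z => ?_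
    simp only [MonObj.comp_one, Category.assoc]
    constructor
    · intro H W w h
      exact H w _ ⟨h, rfl⟩
    · rintro H W w _ ⟨h, rfl⟩
      exact H w h

/-- The composite of `Q`-relations, in diagrammatic order. -/
noncomputable def comp {A B D : C} (R : Rel Q A B) (S : Rel Q B D) : Rel Q A D :=
  (exists_isComposite R S).choose

theorem isComposite_comp {A B D : C} (R : Rel Q A B) (S : Rel Q B D) :
    IsComposite R S (comp R S) :=
  (exists_isComposite R S).choose_spec

/-- The graph of a morphism. -/
noncomputable def graph (Q : InternalQuantale C) {A B : C} (f : A ⟶ B) : Rel Q A B :=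
  (exists_isGraph Q f).choose

theorem isGraph_graph (Q : InternalQuantale C) {A B : C} (f : A ⟶ B) : IsGraph f (graph Q f) :=
  (exists_isGraph Q f).choose_spec

theorem isIdentity_graph_id (Q : InternalQuantale C) (A : C) : IsIdentity (graph Q (𝟙 A)) := by
  simpa [IsGraph, IsIdentity] using isGraph_graph Q (𝟙 A)

theorem isJoin_comp_val {A B D : C} (R : Rel Q A B) (S : Rel Q B D) {X : C} (a : X ⟶ A)
    (d : X ⟶ D) : Q.IsJoin (fun Z z t => ∃ b : Z ⟶ B, t = val R (z ≫ a) b * val S b (z ≫ d))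
      (val (comp R S) a d) := by
  simpa [val] using IsJoin.comp (isComposite_comp R S) (lift a d)

theorem isJoin_graph_val {A B : C} (f : A ⟶ B) {X : C} (a : X ⟶ A) (b : X ⟶ B) :
    Q.IsJoin (fun _ z t => z ≫ a ≫ f = z ≫ b ∧ t = 1) (val (graph Q f) a b) := by
  simpa [val] using IsJoin.comp (isGraph_graph Q f) (lift a b)

theorem comp_val_le_iff {A B D : C} (R : Rel Q A B) (S : Rel Q B D) {X : C} (a : X ⟶ A)
    (d : X ⟶ D) (q : X ⟶ Q.obj) :
    Q.LE (val (comp R S) a d) q ↔ ∀ ⦃Z : C⦄ (z : Z ⟶ X) (b : Z ⟶ B),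
      Q.LE (val R (z ≫ a) b * val S b (z ≫ d)) (z ≫ q) := by
  rw [(isJoin_comp_val R S a d).le_iff]
  exact ⟨fun H Z z b => H z _ ⟨b, rfl⟩, by rintro H Z z _ ⟨b, rfl⟩; exact H z b⟩

theorem mul_le_comp_val {A B D : C} (R : Rel Q A B) (S : Rel Q B D) {X : C} (a : X ⟶ A)
    (b : X ⟶ B) (d : X ⟶ D) : Q.LE (val R a b * val S b d) (val (comp R S) a d) :=
  (isJoin_comp_val R S a d).le ⟨b, by simp⟩

theorem mul_comp_val_le_iff {A B D : C} (R : Rel Q A B) (S : Rel Q B D) {X : C} (a : X ⟶ A)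
    (d : X ⟶ D) (p q : X ⟶ Q.obj) :
    Q.LE (p * val (comp R S) a d) q ↔ ∀ ⦃Z : C⦄ (z : Z ⟶ X) (b : Z ⟶ B),
      Q.LE ((z ≫ p) * (val R (z ≫ a) b * val S b (z ≫ d))) (z ≫ q) := by
  rw [mul_isJoin_le_iff (isJoin_comp_val R S a d)]
  exact ⟨fun H Z z b => H z _ ⟨b, rfl⟩, by rintro H Z z _ ⟨b, rfl⟩; exact H z b⟩

theorem graph_val_le_iff {A B : C} (f : A ⟶ B) {X : C} (a : X ⟶ A) (b : X ⟶ B)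
    (q : X ⟶ Q.obj) :
    Q.LE (val (graph Q f) a b) q ↔
      ∀ ⦃Z : C⦄ (z : Z ⟶ X), z ≫ a ≫ f = z ≫ b → Q.LE 1 (z ≫ q) := by
  rw [(isJoin_graph_val f a b).le_iff]
  exact ⟨fun H Z z h => H z _ ⟨h, rfl⟩, by rintro H Z z _ ⟨h, rfl⟩; exact H z h⟩

theorem graph_val_eq_one {A B : C} (f : A ⟶ B) {X : C} {a : X ⟶ A} {b : X ⟶ B}
    (h : a ≫ f = b) : val (graph Q f) a b = 1 := by
  refine Q.eq_of_forall_le_iff fun q => ?_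
  rw [graph_val_le_iff]
  constructor
  · intro H
    simpa using H (𝟙 X) (by simp [h])
  · intro H Z z _
    simpa [MonObj.comp_one] using H.comp z

theorem graph_val_congr {A B A' B' : C} (f : A ⟶ B) (f' : A' ⟶ B') {X : C} (a : X ⟶ A)
    (b : X ⟶ B) (a' : X ⟶ A') (b' : X ⟶ B')
    (h : ∀ ⦃Z : C⦄ (z : Z ⟶ X), z ≫ a ≫ f = z ≫ b ↔ z ≫ a' ≫ f' = z ≫ b') :
    val (graph Q f) a b = val (graph Q f') a' b' := by
  refine Q.eq_of_forall_le_iff fun q => ?_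
  simp only [graph_val_le_iff, h]

theorem tensor_val {A B A' B' : C} (R : Rel Q A B) (R' : Rel Q A' B') {X : C} (a : X ⟶ A ⊗ A')
    (b : X ⟶ B ⊗ B') : val (tensor R R') a b =
      val R (a ≫ fst _ _) (b ≫ fst _ _) * val R' (a ≫ snd _ _) (b ≫ snd _ _) := by
  change lift a b ≫ tensor R R' = _
  simp only [tensor, MonObj.comp_mul, comp_val, lift_fst_assoc, lift_snd_assoc]

theorem comp_mono {A B D : C} {R R' : Rel Q A B} {S S' : Rel Q B D} (h : Sub R R')
    (h' : Sub S S') : Sub (comp R S) (comp R' S') := by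
  intro X a d
  rw [comp_val_le_iff]
  intro Z z b
  rw [comp_val]
  exact (mul_le_mul (h _ _) (h' _ _)).trans (mul_le_comp_val R' S' _ _ _)

theorem tensor_mono {A B A' B' : C} {R S : Rel Q A B} {R' S' : Rel Q A' B'} (h : Sub R S)
    (h' : Sub R' S') : Sub (tensor R R') (tensor S S') := by
  intro X a b
  rw [tensor_val, tensor_val]
  exact mul_le_mul (h _ _) (h' _ _)

/-- Since `e` is invertible, only `b = e⁻¹(d)` contributes to the join. -/
theorem comp_graph_val {A B D : C} (R : Rel Q A B) (e : B ≅ D) {X : C} (a : X ⟶ A)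
    (d : X ⟶ D) : val (comp R (graph Q e.hom)) a d = val R a (d ≫ e.inv) := by
  refine Q.eq_of_forall_le_iff fun q => ?_
  rw [comp_val_le_iff]
  constructor
  · intro H
    have := H (𝟙 X) (d ≫ e.inv)
    rwa [graph_val_eq_one _ (by simp), _root_.mul_one, Category.id_comp, Category.id_comp] at this
  · intro H Z z b
    rw [mul_isJoin_le_iff (isJoin_graph_val _ _ _)]
    rintro W w _ ⟨h, rfl⟩
    have hb : w ≫ b = w ≫ z ≫ d ≫ e.inv := by
      rw [← cancel_mono e.hom]
      simpa using h
    rw [_root_.mul_one, comp_val, hb]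
    simpa [comp_val] using H.comp (w ≫ z)

section Commutative

variable (hQ : Q.IsCommutative)
include hQ

theorem comp_val_mul_le_iff {A B D : C} (R : Rel Q A B) (S : Rel Q B D) {X : C} (a : X ⟶ A)
    (d : X ⟶ D) (p q : X ⟶ Q.obj) :
    Q.LE (val (comp R S) a d * p) q ↔ ∀ ⦃Z : C⦄ (z : Z ⟶ X) (b : Z ⟶ B),
      Q.LE (val R (z ≫ a) b * val S b (z ≫ d) * (z ≫ p)) (z ≫ q) := by
  rw [hQ, mul_comp_val_le_iff]
  simp only [hQ (_ ≫ p)]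

/-- Either side is below `q` exactly when `R(a, b) * S(b, d) * T(d, e) ≤ q` for all `b` and `d`. -/
theorem comp_assoc {A B D E : C} (R : Rel Q A B) (S : Rel Q B D) (T : Rel Q D E) :
    comp (comp R S) T = comp R (comp S T) := by
  refine ext_val fun X a e => Q.eq_of_forall_le_iff fun q => ?_
  simp only [comp_val_le_iff, mul_comp_val_le_iff, comp_val_mul_le_iff hQ, comp_val]
  constructor
  · intro H Z z b W w d
    simpa [_root_.mul_assoc] using H (w ≫ z) d (𝟙 W) (w ≫ b)
  · intro H Z z d W w b
    simpa [_root_.mul_assoc] using H (w ≫ z) b (𝟙 W) (w ≫ d)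

/-- Only `b = f(a)` contributes to the join, so precomposition with a graph is substitution. -/
theorem graph_comp_val {A B D : C} (f : A ⟶ B) (S : Rel Q B D) {X : C} (a : X ⟶ A)
    (d : X ⟶ D) : val (comp (graph Q f) S) a d = val S (a ≫ f) d := by
  refine Q.eq_of_forall_le_iff fun q => ?_
  rw [comp_val_le_iff]
  constructor
  · intro H
    have := H (𝟙 X) (a ≫ f)
    rwa [graph_val_eq_one _ (by simp), _root_.one_mul, Category.id_comp, Category.id_comp] at this
  · intro H Z z b
    rw [hQ.isJoin_mul_le_iff (isJoin_graph_val _ _ _)]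
    rintro W w _ ⟨h, rfl⟩
    rw [_root_.one_mul, comp_val, ← h]
    simpa [comp_val] using H.comp (w ≫ z)

theorem graph_comp_graph {A B D : C} (f : A ⟶ B) (g : B ⟶ D) :
    comp (graph Q f) (graph Q g) = graph Q (f ≫ g) := by
  refine ext_val fun X a d => ?_
  rw [graph_comp_val hQ]
  exact graph_val_congr _ _ _ _ _ _ (by simp)

theorem id_comp {A B : C} (R : Rel Q A B) : comp (graph Q (𝟙 A)) R = R :=
  ext_val fun X a b => by rw [graph_comp_val hQ, Category.comp_id]

theorem tensor_graph {A B A' B' : C} (f : A ⟶ B) (g : A' ⟶ B') :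
    tensor (graph Q f) (graph Q g) = graph Q (f ⊗ₘ g) := by
  refine ext_val fun X a b => Q.eq_of_forall_le_iff fun q => ?_
  rw [tensor_val, graph_val_le_iff, hQ.isJoin_mul_le_iff (isJoin_graph_val _ _ _)]
  constructor
  · intro H Z z h
    have := H z 1 ⟨by simpa using congr($h ≫ fst _ _), rfl⟩
    rw [_root_.one_mul, comp_val, graph_val_eq_one] at this
    · exact this
    · simpa using congr($h ≫ snd _ _)
  · rintro H Z z _ ⟨h, rfl⟩
    rw [_root_.one_mul, comp_val, graph_val_le_iff]
    intro W w h'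
    rw [← Category.assoc]
    refine H (w ≫ z) ?_
    ext
    · simpa using congr(w ≫ $h)
    · simpa using h'

/-- An element of `B ⊗ B'` is a pair, so one join over pairs equals two separate joins;
commutativity of `Q` rearranges the four factors. -/
theorem tensor_comp {A B D A' B' D' : C} (R : Rel Q A B) (S : Rel Q B D) (R' : Rel Q A' B')
    (S' : Rel Q B' D') :
    comp (tensor R R') (tensor S S') = tensor (comp R S) (comp R' S') := by
  refine ext_val fun X a d => Q.eq_of_forall_le_iff fun q => ?_
  simp only [tensor_val, comp_val_le_iff, comp_val_mul_le_iff hQ, mul_comp_val_le_iff, comp_val,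
    MonObj.comp_mul]
  constructor
  · intro H Z z b W w b'
    have := H (w ≫ z) (lift (w ≫ b) b')
    rw [hQ.mul_mul_mul_comm] at this
    simpa using this
  · intro H Z z b
    rw [hQ.mul_mul_mul_comm]
    simpa using H z (b ≫ fst _ _) (𝟙 Z) (b ≫ snd _ _)

end Commutative

theorem comp_id {A B : C} (R : Rel Q A B) : comp R (graph Q (𝟙 B)) = R :=
  ext_val fun X a b => by
    rw [← Iso.refl_hom, comp_graph_val, Iso.refl_inv, Category.comp_id]

end Rel

/-! ### Homomorphisms and the closure properties of algebraic relations. -/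

section Algebraic

open InternalPoset InternalQuantale QRel.Rel

variable {C : Type u} [Category.{v} C] [HasFiniteLimits C] {V : Variety.{w}}

theorem Alg.comp_app (A : Alg V C) {n : ℕ} (σ : V.Op n) {X Y : C} (f : Y ⟶ X)
    (a : Fin n → (X ⟶ A.carrier)) : f ≫ A.app σ a = A.app σ fun i => f ≫ a i := by
  rw [Alg.app, Alg.app, ← Category.assoc]
  congr 1
  ext
  simp

/-- Homomorphisms of algebras. -/
def IsHom (A B : Alg V C) (f : A.carrier ⟶ B.carrier) : Prop :=
  ∀ ⦃n : ℕ⦄ (σ : V.Op n) ⦃X : C⦄ (a : Fin n → (X ⟶ A.carrier)),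
    A.app σ a ≫ f = B.app σ fun i => a i ≫ f

theorem IsHom.inv {A B : Alg V C} {e : A.carrier ≅ B.carrier} (h : IsHom A B e.hom) :
    IsHom B A e.inv := by
  intro n σ X a
  rw [← cancel_mono e.hom, h]
  simp

theorem isHom_id (A : Alg V C) : IsHom A A (𝟙 A.carrier) := by
  intro n σ X a
  simp

variable [CartesianMonoidalCategory C]

theorem Alg.prod_app_fst (A B : Alg V C) {n : ℕ} (σ : V.Op n) {X : C}
    (a : Fin n → (X ⟶ A.carrier ⊗ B.carrier)) :
    (A.prod B).app σ a ≫ fst A.carrier B.carrier =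
      A.app σ fun i => a i ≫ fst A.carrier B.carrier := by
  simp only [Alg.app, Category.assoc, lift_fst]
  rw [← Category.assoc]
  congr 1
  ext
  simp

theorem Alg.prod_app_snd (A B : Alg V C) {n : ℕ} (σ : V.Op n) {X : C}
    (a : Fin n → (X ⟶ A.carrier ⊗ B.carrier)) :
    (A.prod B).app σ a ≫ snd A.carrier B.carrier =
      B.app σ fun i => a i ≫ snd A.carrier B.carrier := by
  simp only [Alg.app, Category.assoc, lift_snd]
  rw [← Category.assoc]
  congr 1
  ext
  simp

theorem isHom_fst (A B : Alg V C) : IsHom (A.prod B) A (fst A.carrier B.carrier) :=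
  fun _ σ _ a => A.prod_app_fst B σ a

theorem isHom_snd (A B : Alg V C) : IsHom (A.prod B) B (snd A.carrier B.carrier) :=
  fun _ σ _ a => A.prod_app_snd B σ a

theorem IsHom.comp {A B D : Alg V C} {f : A.carrier ⟶ B.carrier} {g : B.carrier ⟶ D.carrier}
    (hf : IsHom A B f) (hg : IsHom B D g) : IsHom A D (f ≫ g) := by
  intro n σ X a
  rw [← Category.assoc, hf, hg]
  simp only [Category.assoc]

theorem IsHom.of_fst_snd {A B D : Alg V C} {f : A.carrier ⟶ B.carrier ⊗ D.carrier}
    (h₁ : IsHom A B (f ≫ fst _ _)) (h₂ : IsHom A D (f ≫ snd _ _)) : IsHom A (B.prod D) f := by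
  intro n σ X a
  apply CartesianMonoidalCategory.hom_ext
  · rw [Category.assoc, h₁, Alg.prod_app_fst]
    simp only [Category.assoc]
  · rw [Category.assoc, h₂, Alg.prod_app_snd]
    simp only [Category.assoc]

theorem isHom_associator (A B D : Alg V C) : IsHom ((A.prod B).prod D) (A.prod (B.prod D))
    (α_ A.carrier B.carrier D.carrier).hom := by
  refine IsHom.of_fst_snd ?_ (IsHom.of_fst_snd ?_ ?_)
  · rw [associator_hom_fst]
    exact (isHom_fst (A.prod B) D).comp (isHom_fst A B)
  · rw [Category.assoc, associator_hom_snd_fst]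
    exact (isHom_fst (A.prod B) D).comp (isHom_snd A B)
  · rw [Category.assoc, associator_hom_snd_snd]
    exact isHom_snd (A.prod B) D

theorem isHom_leftUnitor (A : Alg V C) : IsHom (Alg.unit.prod A) A (λ_ A.carrier).hom := by
  rw [leftUnitor_hom]
  exact isHom_snd Alg.unit A

theorem isHom_rightUnitor (A : Alg V C) : IsHom (A.prod Alg.unit) A (ρ_ A.carrier).hom := by
  rw [rightUnitor_hom]
  exact isHom_fst A Alg.unit

theorem isHom_braiding [BraidedCategory C] (A B : Alg V C) :
    IsHom (A.prod B) (B.prod A) (β_ A.carrier B.carrier).hom := by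
  refine IsHom.of_fst_snd ?_ ?_
  · rw [braiding_hom_fst]
    exact isHom_snd A B
  · rw [braiding_hom_snd]
    exact isHom_fst A B

variable [MonoidalClosed C] [HasSubobjectClassifier C] {Q : InternalQuantale C}

/-- By distributivity it suffices to look at stages where `f(aᵢ) = bᵢ` for all `i`. There every
factor is `1`, and so is the right-hand side, because `f` is a homomorphism. -/
theorem isAlgebraic_graph (hQ : Q.IsCommutative) {A B : Alg V C} {f : A.carrier ⟶ B.carrier}
    (hf : IsHom A B f) : IsAlgebraic Q A B (graph Q f) := by
  intro n σ X a b
  refine hQ.prod_isJoin_le ?_ (fun i => isJoin_graph_val f (a i) (b i)) _ ?_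
  · rintro i Z W w z _ ⟨h, rfl⟩
    exact ⟨by simpa using congr(w ≫ $h), MonObj.comp_one _⟩
  · intro Z z t ht
    rw [comp_val, graph_val_eq_one, show t = fun _ => 1 from funext fun i => (ht i).2]
    · simpa using Q.le_refl _
    · rw [Alg.comp_app, hf, Alg.comp_app]
      congr 1
      funext i
      simpa using (ht i).1

/-- After distributing, each factor has its own intermediate element `bᵢ`. Commutativity separates
the `R`-factors from the `S`-factors, and `σ(b₁, …, bₙ)` is an intermediate element for the
composite. -/
theorem isAlgebraic_comp (hQ : Q.IsCommutative) {A B D : Alg V C}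
    {R : Rel Q A.carrier B.carrier} {S : Rel Q B.carrier D.carrier} (hR : IsAlgebraic Q A B R)
    (hS : IsAlgebraic Q B D S) : IsAlgebraic Q A D (comp R S) := by
  intro n σ X a d
  refine hQ.prod_isJoin_le ?_ (fun i => isJoin_comp_val R S (a i) (d i)) _ ?_
  · rintro i Z W w z _ ⟨b, rfl⟩
    exact ⟨w ≫ b, by simp [MonObj.comp_mul, comp_val]⟩
  · intro Z z t ht
    choose b hb using ht
    rw [comp_val, Alg.comp_app, Alg.comp_app, funext hb, hQ.prod_mul]
    exact (mul_le_mul (hR σ _ b) (hS σ b _)).trans (mul_le_comp_val R S _ _ _)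

theorem isAlgebraic_tensor (hQ : Q.IsCommutative) {A B A' B' : Alg V C}
    {R : Rel Q A.carrier B.carrier} {R' : Rel Q A'.carrier B'.carrier} (hR : IsAlgebraic Q A B R)
    (hR' : IsAlgebraic Q A' B' R') :
    IsAlgebraic Q (A.prod A') (B.prod B') (tensor R R') := by
  intro n σ X a b
  simp only [tensor_val]
  rw [hQ.prod_mul, Alg.prod_app_fst, Alg.prod_app_fst, Alg.prod_app_snd, Alg.prod_app_snd]
  exact mul_le_mul (hR σ _ _) (hR' σ _ _)

end Algebraic

/-! ### The ordered symmetric monoidal category of algebraic relations. -/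

section RelAlg

open QRel.Rel

variable {C : Type u} [Category.{v} C] [HasFiniteLimits C] [CartesianMonoidalCategory C]
  [MonoidalClosed C] [HasSubobjectClassifier C]

/-- The `(Σ, E)`-algebras, as objects of the category of algebraic relations with values in the
commutative quantale `Q`. -/
def RelAlg (V : Variety.{w}) (Q : InternalQuantale C) (_ : Q.IsCommutative) := Alg V C

namespace RelAlg

variable {V : Variety.{w}} {Q : InternalQuantale C} {hQ : Q.IsCommutative}

noncomputable instance : Category.{v} (RelAlg V Q hQ) where
  Hom A B := AlgRel Q A B
  id A := ⟨graph Q (𝟙 (Alg.carrier A)), isAlgebraic_graph hQ (isHom_id A)⟩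
  comp R S := ⟨Rel.comp R.1 S.1, isAlgebraic_comp hQ R.2 S.2⟩
  id_comp R := Subtype.ext (Rel.id_comp hQ R.1)
  comp_id R := Subtype.ext (Rel.comp_id R.1)
  assoc R S T := Subtype.ext (Rel.comp_assoc hQ R.1 S.1 T.1)

/-- The graph of an invertible homomorphism is an isomorphism. -/
noncomputable def graphIso {A B : Alg V C} (e : A.carrier ≅ B.carrier) (he : IsHom A B e.hom) :
    @Iso (RelAlg V Q hQ) _ A B where
  hom := ⟨graph Q e.hom, isAlgebraic_graph hQ he⟩
  inv := ⟨graph Q e.inv, isAlgebraic_graph hQ he.inv⟩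
  hom_inv_id := Subtype.ext <| (graph_comp_graph hQ _ _).trans (by rw [e.hom_inv_id]; rfl)
  inv_hom_id := Subtype.ext <| (graph_comp_graph hQ _ _).trans (by rw [e.inv_hom_id]; rfl)

noncomputable instance : MonoidalCategoryStruct (RelAlg V Q hQ) where
  tensorObj A B := Alg.prod A B
  tensorUnit := Alg.unit
  tensorHom R S := ⟨tensor R.1 S.1, isAlgebraic_tensor hQ R.2 S.2⟩
  whiskerLeft A _ _ R := ⟨tensor (𝟙 A : AlgRel Q A A).1 R.1,
    isAlgebraic_tensor hQ (𝟙 A : AlgRel Q A A).2 R.2⟩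
  whiskerRight R A := ⟨tensor R.1 (𝟙 A : AlgRel Q A A).1,
    isAlgebraic_tensor hQ R.2 (𝟙 A : AlgRel Q A A).2⟩
  associator A B D := graphIso (α_ _ _ _) (isHom_associator A B D)
  leftUnitor A := graphIso (λ_ _) (isHom_leftUnitor A)
  rightUnitor A := graphIso (ρ_ _) (isHom_rightUnitor A)

/-- Naturality is checked on values, where composing with a coherence graph is substitution. In
pentagon and triangle both sides are graphs, so the identities of `C` suffice. -/
noncomputable instance : MonoidalCategory (RelAlg V Q hQ) :=
  MonoidalCategory.ofTensorHom
    (id_tensorHom_id := fun A B => Subtype.ext <| (tensor_graph hQ _ _).trans (by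
      rw [id_tensorHom_id]; rfl))
    (id_tensorHom := fun _ _ _ _ => rfl)
    (tensorHom_id := fun _ _ => rfl)
    (tensorHom_comp_tensorHom := fun R R' S S' => Subtype.ext (tensor_comp hQ R.1 S.1 R'.1 S'.1))
    (associator_naturality := fun R S T => Subtype.ext <| by
      change Rel.comp (tensor (tensor R.1 S.1) T.1) (graph Q (α_ _ _ _).hom) =
        Rel.comp (graph Q (α_ _ _ _).hom) (tensor R.1 (tensor S.1 T.1))
      refine ext_val fun X a d => ?_
      rw [comp_graph_val, graph_comp_val hQ]
      simp [tensor_val, _root_.mul_assoc])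
    (leftUnitor_naturality := fun R => Subtype.ext <| by
      change Rel.comp (tensor (graph Q (𝟙 (𝟙_ C))) R.1) (graph Q (λ_ _).hom) =
        Rel.comp (graph Q (λ_ _).hom) R.1
      refine ext_val fun X a d => ?_
      -- Any two elements of the terminal object are equal, so its identity relation has constant
      -- value `1`.
      rw [comp_graph_val, graph_comp_val hQ, tensor_val, graph_val_eq_one _ (toUnit_unique _ _),
        _root_.one_mul]
      simp [leftUnitor_hom])
    (rightUnitor_naturality := fun R => Subtype.ext <| by
      change Rel.comp (tensor R.1 (graph Q (𝟙 (𝟙_ C)))) (graph Q (ρ_ _).hom) =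
        Rel.comp (graph Q (ρ_ _).hom) R.1
      refine ext_val fun X a d => ?_
      rw [comp_graph_val, graph_comp_val hQ, tensor_val, graph_val_eq_one (𝟙 (𝟙_ C))
        (toUnit_unique _ _), _root_.mul_one]
      simp [rightUnitor_hom])
    (pentagon := fun A B D E => Subtype.ext <| by
      change Rel.comp (tensor (graph Q (α_ _ _ _).hom) (graph Q (𝟙 (Alg.carrier E))))
          (Rel.comp (graph Q (α_ _ _ _).hom)
            (tensor (graph Q (𝟙 (Alg.carrier A))) (graph Q (α_ _ _ _).hom))) =
        Rel.comp (graph Q (α_ _ _ _).hom) (graph Q (α_ _ _ _).hom)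
      simp only [tensor_graph hQ, graph_comp_graph hQ]
      congr 1
      simp)
    (triangle := fun A B => Subtype.ext <| by
      change Rel.comp (graph Q (α_ _ _ _).hom)
          (tensor (graph Q (𝟙 (Alg.carrier A))) (graph Q (λ_ _).hom)) =
        tensor (graph Q (ρ_ _).hom) (graph Q (𝟙 (Alg.carrier B)))
      simp only [tensor_graph hQ, graph_comp_graph hQ]
      congr 1
      simp)

variable [BraidedCategory C]

noncomputable instance : SymmetricCategory (RelAlg V Q hQ) where
  braiding A B := graphIso (β_ _ _) (isHom_braiding A B)
  braiding_naturality_right A B D R := Subtype.ext <| by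
    change Rel.comp (tensor (graph Q (𝟙 (Alg.carrier A))) R.1) (graph Q (β_ _ _).hom) =
      Rel.comp (graph Q (β_ _ _).hom) (tensor R.1 (graph Q (𝟙 (Alg.carrier A))))
    refine ext_val fun X a d => ?_
    rw [comp_graph_val, graph_comp_val hQ, tensor_val, tensor_val, hQ]
    simp
  braiding_naturality_left R A := Subtype.ext <| by
    change Rel.comp (tensor R.1 (graph Q (𝟙 (Alg.carrier A)))) (graph Q (β_ _ _).hom) =
      Rel.comp (graph Q (β_ _ _).hom) (tensor (graph Q (𝟙 (Alg.carrier A))) R.1)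
    refine ext_val fun X a d => ?_
    rw [comp_graph_val, graph_comp_val hQ, tensor_val, tensor_val, hQ]
    simp
  hexagon_forward A B D := Subtype.ext <| by
    change Rel.comp (graph Q (α_ _ _ _).hom)
        (Rel.comp (graph Q (β_ _ (_ ⊗ _)).hom) (graph Q (α_ _ _ _).hom)) =
      Rel.comp (tensor (graph Q (β_ _ _).hom) (graph Q (𝟙 (Alg.carrier D))))
        (Rel.comp (graph Q (α_ _ _ _).hom)
          (tensor (graph Q (𝟙 (Alg.carrier B))) (graph Q (β_ _ _).hom)))
    simp only [tensor_graph hQ, graph_comp_graph hQ]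
    congr 1
    simp
  hexagon_reverse A B D := Subtype.ext <| by
    change Rel.comp (graph Q (α_ _ _ _).inv)
        (Rel.comp (graph Q (β_ (_ ⊗ _) _).hom) (graph Q (α_ _ _ _).inv)) =
      Rel.comp (tensor (graph Q (𝟙 (Alg.carrier A))) (graph Q (β_ _ _).hom))
        (Rel.comp (graph Q (α_ _ _ _).inv)
          (tensor (graph Q (β_ _ _).hom) (graph Q (𝟙 (Alg.carrier B)))))
    simp only [tensor_graph hQ, graph_comp_graph hQ]
    congr 1
    simp
  symmetry A B := Subtype.ext <| by
    change Rel.comp (graph Q (β_ _ _).hom) (graph Q (β_ _ _).hom) = graph Q (𝟙 (_ ⊗ _))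
    rw [graph_comp_graph hQ]
    congr 1
    -- In a cartesian category the projections determine the braiding, so any braiding is symmetric.
    ext <;> simp

instance (A B : RelAlg V Q hQ) : PartialOrder (A ⟶ B) where
  le R S := Sub R.1 S.1
  le_refl R _ _ _ := Q.le_refl _
  le_trans _ _ _ h h' _ a b := (h a b).trans (h' a b)
  le_antisymm R S h h' := Subtype.ext <| ext_val fun _ a b => Q.antisymm _ _ (h a b) (h' a b)

theorem isPartiallyOrderedSMC : IsPartiallyOrderedSMC (RelAlg V Q hQ) where
  comp_mono h h' := Rel.comp_mono h h'
  tensor_mono h h' := Rel.tensor_mono h h'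

end RelAlg

end RelAlg

end QRel

theorem mainTheorem12 {C : Type u} [Category.{v} C] [HasFiniteLimits C]
    [CartesianMonoidalCategory C] [BraidedCategory C] [MonoidalClosed C] [HasSubobjectClassifier C]
    (V : QRel.Variety.{w}) (Q : QRel.InternalQuantale C) (hQ : Q.IsCommutative) :
    -- a symmetric monoidal category on the algebras, with ordered hom-sets
    ∃ (_ : Category.{v} (QRel.Alg V C)) (_ : MonoidalCategory (QRel.Alg V C))
      (_ : SymmetricCategory (QRel.Alg V C))
      (_ : ∀ A B : QRel.Alg V C, PartialOrder (A ⟶ B)),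
      QRel.IsPartiallyOrderedSMC (QRel.Alg V C) ∧
    -- whose morphisms are the algebraic relations, with the pointwise order
    ∃ r : ∀ {A B : QRel.Alg V C}, (A ⟶ B) ≃ QRel.AlgRel Q A B,
      (∀ {A B : QRel.Alg V C} (f g : A ⟶ B), f ≤ g ↔ (r f).rel.Sub (r g).rel) ∧
    -- with relational identities and composition
      (∀ A : QRel.Alg V C, (r (𝟙 A)).rel.IsIdentity) ∧
      (∀ {A B D : QRel.Alg V C} (f : A ⟶ B) (g : B ⟶ D),
        (r f).rel.IsComposite (r g).rel (r (f ≫ g)).rel) ∧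
    -- whose tensor is the product of algebras and the pointwise product of relations
    ∃ (hU : 𝟙_ (QRel.Alg V C) = QRel.Alg.unit)
      (hT : ∀ A B : QRel.Alg V C, A ⊗ B = A.prod B),
      (∀ {A B A' B' : QRel.Alg V C} (f : A ⟶ B) (g : A' ⟶ B'),
        (r (f ⊗ₘ g)).relOf (hT A A') (hT B B') = (r f).rel.tensor (r g).rel) ∧
    -- and whose coherence isomorphisms are the graphs of those of the finite products of `C`
      (∀ A B D : QRel.Alg V C,
        QRel.Rel.IsGraph (α_ A.carrier B.carrier D.carrier).hom
          ((r (α_ A B D).hom).relOf (A' := (A.prod B).prod D) (B' := A.prod (B.prod D))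
            (by rw [hT, hT]) (by rw [hT, hT]))) ∧
      (∀ A : QRel.Alg V C,
        QRel.Rel.IsGraph (λ_ A.carrier).hom
          ((r (λ_ A).hom).relOf (A' := QRel.Alg.unit.prod A) (by rw [hT, hU]) rfl)) ∧
      (∀ A : QRel.Alg V C,
        QRel.Rel.IsGraph (ρ_ A.carrier).hom
          ((r (ρ_ A).hom).relOf (A' := A.prod QRel.Alg.unit) (by rw [hT, hU]) rfl)) ∧
      (∀ A B : QRel.Alg V C,
        QRel.Rel.IsGraph (β_ A.carrier B.carrier).hom
          ((r (β_ A B).hom).relOf (hT A B) (hT B A))) := by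
  -- The equalities for unit and tensor hold by `rfl`, so the transports in `relOf` reduce to the
  -- identity and each coherence clause is `isGraph_graph`.
  refine ⟨(inferInstance : Category.{v} (QRel.RelAlg V Q hQ)),
    (inferInstance : MonoidalCategory (QRel.RelAlg V Q hQ)),
    (inferInstance : SymmetricCategory (QRel.RelAlg V Q hQ)),
    (inferInstance : ∀ A B : QRel.RelAlg V Q hQ, PartialOrder (A ⟶ B)),
    QRel.RelAlg.isPartiallyOrderedSMC, fun {A B} => Equiv.refl _, fun _ _ => Iff.rfl,
    fun A => QRel.Rel.isIdentity_graph_id Q A.carrier,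
    fun f g => QRel.Rel.isComposite_comp f.1 g.1, rfl, fun _ _ => rfl, fun _ _ => rfl,
    fun _ _ _ => QRel.Rel.isGraph_graph Q _, fun _ => QRel.Rel.isGraph_graph Q _,
    fun _ => QRel.Rel.isGraph_graph Q _, fun _ _ => QRel.Rel.isGraph_graph Q _⟩
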